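/- Let $\alpha\in(0,1)$ and let $(X_k)_{k\ge 1}$ be i.i.d. non-negative random variables whose tail is regularly varying, i.e. $\mathbb P[X_1\ge u]=L(u)/u^{\alpha}$ for $u>0$, where $L$ is slowly varying at infinity. Put $\tilde a_N=\inf\{u:\mathbb P[X_1\ge u]\le 1/N\}$. Let $(G_{N,k})_{N\ge 1,\,1\le k\le N}$ be a bounded triangular array of complex numbers whose empirical measures $\nu_N=\frac1N\sum_{k=1}^N\delta_{G_{N,k}}$ converge weakly to a probability measure $\nu$ on $\mathbb C$. Let $$C_\alpha^{-1}=\frac{\Gamma(2-\alpha)\cos(\pi\alpha/2)}{1-\alpha},$$ and let $\Gamma_\nu$ be the measure on the unit circle $S^1$ that is the image of the measure $C_\alpha^{-1}|z|^{\alpha}\,\nu(dz)$ on $\mathbb C$ under the map $z\mapsto z/|z|$ (the point $z=0$ has no mass for $C_\alpha^{-1}|z|^{\alpha}\,\nu(dz)$). Write $\langle t,s\rangle=\Re t\,\Re s+\Im t\,\Im s$ for $t,s\in\mathbb C$. Then the normalized sums $$S_N=\frac1{\tilde a_N}\sum_{k=1}^N G_{N,k}X_k$$ converge in distribution, as $N\to\infty$,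 to the complex $\alpha$-stable distribution with spectral representation $(\Gamma_\nu,0)$: the measure $\Gamma_\nu$ is finite, there is a probability measure $Q$ on $\mathbb C$ with $$\int_{\mathbb C} e^{i\langle t,y\rangle}\,Q(dy)=\exp\Big[-\int_{S^1}|\langle t,s\rangle|^{\alpha}\Big(1-i\,\mathrm{sign}(\langle t,s\rangle)\tan\frac{\pi\alpha}{2}\Big)\Gamma_\nu(ds)\Big]\qquad(t\in\mathbb C),$$ and the law of $S_N$ converges weakly to $Q$. In particular, if $\nu=\delta_0$, then $S_N$ converges in distribution to $0$. -/

import Mathlib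

open MeasureTheory ProbabilityTheory Filter Topology
open scoped NNReal ENNReal

/-- A slowly varying function at infinity. -/
structure IsSlowlyVarying (L : ℝ → ℝ) : Prop where
  measurable : Measurable L
  eventually_pos : ∀ᶠ u in atTop, 0 < L u
  tendsto_ratio : ∀ c : ℝ, 0 < c → Tendsto (fun u : ℝ => L (c * u) / L u) atTop (𝓝 1)

/-- The normalizing constant `inf {u : P[Y ≥ u] ≤ 1 / N}`. -/
noncomputable def normConst {Ω : Type*} [MeasurableSpace Ω] (P : Measure Ω) (Y : Ω → ℝ)
    (N : ℕ) : ℝ :=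
  sInf {u : ℝ | P.real {ω | u ≤ Y ω} ≤ 1 / (N : ℝ)}

/-- The empirical measure `(1 / N) ∑ₖ δ_{g k}`; it is a probability measure for `N ≥ 1` (and the
zero measure for `N = 0`). -/
noncomputable def empiricalMeasure {N : ℕ} (g : Fin N → ℂ) : FiniteMeasure ℂ :=
  (N : ℝ≥0)⁻¹ • ∑ k : Fin N, (diracProba (g k)).toFiniteMeasure

/-- The normalized sum `a⁻¹ ∑ₖ g k * X k`, where `a` is the normalizing constant of `X 0`. -/
noncomputable def normalizedSum {Ω : Type*} [MeasurableSpace Ω] (P : Measure Ω) (X : ℕ → Ω → ℝ)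
    {N : ℕ} (g : Fin N → ℂ) (ω : Ω) : ℂ :=
  ((normConst P (X 0) N : ℝ) : ℂ)⁻¹ * ∑ k : Fin N, g k * ((X k ω : ℝ) : ℂ)

/-- The constant `C_α`, for `α ∈ (0, 1)`, given by
`C_α⁻¹ = Γ(2 - α) cos (π α / 2) / (1 - α) = ∫_0^∞ sin x / x ^ α dx` (an improper integral). -/
noncomputable def stableConst (α : ℝ) : ℝ :=
  (Real.Gamma (2 - α) * Real.cos (Real.pi * α / 2) / (1 - α))⁻¹

/-- The map `z ↦ z / |z|` from `ℂ` to the unit circle (with value `1` at `0`). -/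
noncomputable def radialProj (z : ℂ) : Metric.sphere (0 : ℂ) 1 :=
  if h : z = 0 then ⟨1, by simp⟩ else ⟨z / ((‖z‖ : ℝ) : ℂ), by simp [h]⟩

theorem measurable_radialProj : Measurable radialProj := by
  have h : Measurable fun z : ℂ => if z = 0 then (1 : ℂ) else z / ((‖z‖ : ℝ) : ℂ) :=
    Measurable.ite (measurableSet_singleton 0) measurable_const (by fun_prop)
  have h2 : Measurable fun z : ℂ => (radialProj z : ℂ) := by
    convert! h using 2 with z
    by_cases hz : z = 0 <;> simp [radialProj, hz]
  exact h2.subtype_mk (h := fun z => (radialProj z).2)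

/-- The image of the measure `C_α⁻¹ |z| ^ α ν(dz)` under `z ↦ z / |z|`. The density vanishes
at `z = 0`, so the value of `radialProj` there plays no role. -/
noncomputable def spectralMeasure (α : ℝ) (ν : Measure ℂ) : Measure (Metric.sphere (0 : ℂ) 1) :=
  (ν.withDensity fun z => ENNReal.ofReal ((stableConst α)⁻¹ * ‖z‖ ^ α)).map radialProj

/-- `Q` is the complex `α`-stable distribution with spectral representation `(Γ, m)`. Here
`inner ℝ t s = Re t * Re s + Im t * Im s`, and `charFun Q t = ∫ exp (i ⟨t, y⟩) Q(dy)`. -/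
structure IsComplexStable (α : ℝ) (Γ : Measure (Metric.sphere (0 : ℂ) 1)) (m : ℂ)
    (Q : Measure ℂ) : Prop where
  isFiniteMeasure : IsFiniteMeasure Γ
  isProbabilityMeasure : IsProbabilityMeasure Q
  charFun_eq : ∀ t : ℂ, charFun Q t =
    Complex.exp (-(∫ s : Metric.sphere (0 : ℂ) 1,
        ((|inner ℝ t (s : ℂ)| ^ α : ℝ) : ℂ) *
          (1 - Complex.I * ((Real.sign (inner ℝ t (s : ℂ)) * Real.tan (Real.pi * α / 2) : ℝ) : ℂ))
        ∂Γ) + Complex.I * ((inner ℝ m t : ℝ) : ℂ))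

/-! With `a` the normalizing constant, independence makes the characteristic function of the sum at
`t` the product over `k` of `1 - c N k`, where `N * c N k = Φ N ⟨t, G N k⟩` and `Φ N s = N (1 - E
exp (i s X / a))`. If `Φ N` converges locally uniformly to a continuous `ψ`, the sums of the `c N k`
are averages of `Φ N` over a bounded array and tend to `∫ ψ(⟨t, z⟩) ν(dz)`. The factors differ from
1 by `O(1/N)`, so the product tends to the exponential of minus that integral, and Lévy's theorem
produces the limit law.

The analytic core is the limit `ψ s = Γ(1 - α) (-i s) ^ α`. Integrating `exp (i s u)` directly
against the tail gives only conditional convergence, so the limit is found first in the open right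
half-plane (`tendsto_mul_one_sub_laplace`): there the Laplace transform is an absolutely convergent
integral of the tail, `N P[X ≥ a u]` tends to `u ^ (-α)`, and a Potter bound dominates it. The
passage to the imaginary axis uses `X ≥ 0`: damping by `exp (-ε X / a)` costs at most the real
Laplace term at `ε`, which is of order `ε ^ α` in the limit (`norm_integral_exp_mul_I_sub_le`).

Finally `ψ` is homogeneous of degree `α` under positive scaling, so the modulus of `z` goes into the
density `|z| ^ α` and only the direction remains: this is the spectral measure. -/

/-! ### Regular variation: Potter bound and quantile scale -/

/-- A tail function which is regularly varying at infinity with index `-α`. -/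
structure IsRegVaryingTail (α : ℝ) (T : ℝ → ℝ) : Prop where
  antitone : Antitone T
  pos : ∀ u, 0 < T u
  le_one : ∀ u, T u ≤ 1
  eq_one : ∀ u ≤ 0, T u = 1
  tendsto_ratio : ∀ c : ℝ, 0 < c → Tendsto (fun u : ℝ => T (c * u) / T u) atTop (𝓝 (c ^ (-α)))

namespace IsRegVaryingTail

variable {α : ℝ} {T : ℝ → ℝ}

/-- A Potter bound. -/
theorem exists_potter_bound (hT : IsRegVaryingTail α T) {β : ℝ} (hβ : 0 < β) (hαβ : α < β) :
    ∃ C x₀ : ℝ, 0 < C ∧ 0 < x₀ ∧ ∀ x y : ℝ, x₀ ≤ x → 0 < y → y ≤ x →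
      y ^ β * T y ≤ C * (x ^ β * T x) := by
  have h2 : (2⁻¹ : ℝ) ^ (-α) < 2 ^ β := by
    rw [Real.inv_rpow (by norm_num), ← Real.rpow_neg (by norm_num), neg_neg]
    exact Real.rpow_lt_rpow_of_exponent_lt (by norm_num) hαβ
  obtain ⟨x₁, hx₁⟩ := eventually_atTop.1
    ((hT.tendsto_ratio 2⁻¹ (by norm_num)).eventually_lt_const h2)
  set x₀ := max x₁ 1 with hx₀
  have hx₀pos : 0 < x₀ := lt_of_lt_of_le one_pos (le_max_right _ _)
  have hhalf : ∀ x, x₀ ≤ x → T (x / 2) ≤ 2 ^ β * T x := by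
    intro x hx
    have := (hx₁ x ((le_max_left _ _).trans hx)).le
    rw [div_le_iff₀ (hT.pos x)] at this
    rwa [div_eq_inv_mul]
  have h2β : (0 : ℝ) < 2 ^ β := by positivity
  have hT0 := hT.pos (2 * x₀)
  -- Chosen for the base case `y ≤ x < 2 * x₀`. Since `T ≤ 1`, also `2 ^ β ≤ C`, which covers `x / 2
  -- ≤ y ≤ x` in the induction.
  set C := 2 ^ β / T (2 * x₀) with hC
  have hCpos : 0 < C := by positivity
  have hC2 : 2 ^ β ≤ C := by
    rw [hC, le_div_iff₀ hT0]
    exact mul_le_of_le_one_right h2β.le (hT.le_one _)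
  refine ⟨C, x₀, hCpos, hx₀pos, ?_⟩
  -- Dyadic induction on the size of `x`. By `hhalf`, `x ^ β * T x` does not decrease when `x / 2`
  -- is replaced by `x`, so `C` is not lost along the way.
  have key : ∀ n : ℕ, ∀ x y : ℝ, x₀ ≤ x → x < 2 ^ (n + 1) * x₀ → 0 < y → y ≤ x →
      y ^ β * T y ≤ C * (x ^ β * T x) := by
    intro n
    induction n with
    | zero =>
      intro x y hx hx2 hy hyx
      rw [zero_add, pow_one] at hx2
      calc y ^ β * T y ≤ (2 * x₀) ^ β * 1 := by
            gcongr
            · exact (hT.pos _).le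
            · linarith
            · exact hT.le_one y
        _ = C * (x₀ ^ β * T (2 * x₀)) := by
            rw [Real.mul_rpow (by norm_num) hx₀pos.le, hC]
            field_simp
        _ ≤ C * (x ^ β * T x) := by
            gcongr
            · exact Real.rpow_nonneg (hx₀pos.le.trans hx) _
            · exact hT.antitone hx2.le
    | succ n ih =>
      intro x y hx hx2 hy hyx
      rcases lt_or_ge x (2 ^ (n + 1) * x₀) with h | h
      · exact ih x y hx h hy hyx
      have hx0 : 0 < x := hx₀pos.trans_le hx
      have hhx := hhalf x hx
      have hsplit : x ^ β = 2 ^ β * (x / 2) ^ β := by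
        rw [← Real.mul_rpow (by norm_num) (by positivity)]; congr 1; ring
      rcases le_total y (x / 2) with hy2 | hy2
      · refine (ih (x / 2) y ?_ ?_ hy hy2).trans ?_
        · have : (2 : ℝ) * x₀ ≤ 2 ^ (n + 1) * x₀ := by
            gcongr
            exact le_self_pow₀ (by norm_num) (by omega)
          linarith
        · rw [pow_succ] at hx2; linarith
        · gcongr C * ?_
          rw [hsplit]
          calc (x / 2) ^ β * T (x / 2) ≤ (x / 2) ^ β * (2 ^ β * T x) := by gcongr
            _ = _ := by ring
      · calc y ^ β * T y ≤ x ^ β * (2 ^ β * T x) := by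
              gcongr
              · exact (hT.pos _).le
              · exact (hT.antitone hy2).trans hhx
          _ = 2 ^ β * (x ^ β * T x) := by ring
          _ ≤ C * (x ^ β * T x) := by
              have := hT.pos x
              gcongr
  intro x y hx hy hyx
  obtain ⟨n, hn⟩ := pow_unbounded_of_one_lt (x / x₀) (by norm_num : (1 : ℝ) < 2)
  refine key n x y hx ?_ hy hyx
  rw [div_lt_iff₀ hx₀pos] at hn
  refine hn.trans_le ?_
  gcongr <;> norm_num

/-- A nonzero limit of the monotone `T` would make `T (2 * u) / T u` tend to 1 instead of `2 ^ (-α)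
< 1`. -/
theorem tendsto_zero (hT : IsRegVaryingTail α T) (hα : 0 < α) : Tendsto T atTop (𝓝 0) := by
  have hbdd : BddBelow (Set.range T) := ⟨0, by rintro _ ⟨u, rfl⟩; exact (hT.pos u).le⟩
  have hlim := tendsto_atTop_ciInf hT.antitone hbdd
  set l := ⨅ u, T u
  rcases eq_or_ne l 0 with h0 | h0
  · rwa [h0] at hlim
  · have h1 : Tendsto (fun u => T (2 * u) / T u) atTop (𝓝 (l / l)) :=
      (hlim.comp (tendsto_id.const_mul_atTop (by norm_num : (0 : ℝ) < 2))).div hlim h0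
    rw [div_self h0] at h1
    have h2 := tendsto_nhds_unique h1 (hT.tendsto_ratio 2 (by norm_num))
    have h3 : (2 : ℝ) ^ (-α) < 1 := Real.rpow_lt_one_of_one_lt_of_neg (by norm_num) (by linarith)
    exact absurd h2 h3.ne'

/-- The generalized inverse `inf {u : T u ≤ 1 / N}` of a tail function. -/
noncomputable def _root_.tailQuantile (T : ℝ → ℝ) (N : ℕ) : ℝ := sInf {u : ℝ | T u ≤ 1 / (N : ℝ)}

theorem tailQuantile_set_nonempty (hT : IsRegVaryingTail α T) (hα : 0 < α) {N : ℕ} (hN : 0 < N) :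
    {u : ℝ | T u ≤ 1 / (N : ℝ)}.Nonempty := by
  have : (0 : ℝ) < 1 / N := by positivity
  exact ((hT.tendsto_zero hα).eventually_le_const this).exists

theorem le_of_tailQuantile_lt (hT : IsRegVaryingTail α T) (hα : 0 < α) {N : ℕ} (hN : 0 < N) {u : ℝ}
    (hu : tailQuantile T N < u) : T u ≤ 1 / (N : ℝ) := by
  obtain ⟨v, hv, hvu⟩ := exists_lt_of_csInf_lt (hT.tailQuantile_set_nonempty hα hN) hu
  exact (hT.antitone hvu.le).trans hv

theorem lt_of_lt_tailQuantile (hT : IsRegVaryingTail α T) {N : ℕ} (hN : 1 < N) {u : ℝ}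
    (hu : u < tailQuantile T N) : 1 / (N : ℝ) < T u := by
  by_contra! h
  -- The lower bound 0 needs `1 < N`: for `N = 1` the set is all of `ℝ` and `sInf` takes its default
  -- value.
  refine hu.not_ge (csInf_le ⟨0, fun v hv => ?_⟩ h)
  by_contra! hv0
  have h1 : T v ≤ 1 / (N : ℝ) := hv
  rw [hT.eq_one v hv0.le, le_div_iff₀ (by positivity), one_mul] at h1
  exact absurd h1 (by exact_mod_cast hN.not_ge)

theorem tendsto_tailQuantile (hT : IsRegVaryingTail α T) (hα : 0 < α) :
    Tendsto (tailQuantile T) atTop atTop := by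
  refine tendsto_atTop.2 fun u => ?_
  filter_upwards [tendsto_one_div_atTop_nhds_zero_nat.eventually_lt_const (hT.pos u),
    eventually_gt_atTop 0] with N hN hN0
  refine le_csInf (hT.tailQuantile_set_nonempty hα hN0) fun v hv => ?_
  by_contra! hvu
  exact absurd (hN.trans_le ((hT.antitone hvu.le).trans hv)) (lt_irrefl _)

/-- `T` may jump at the quantile, so `N * T` need not equal 1 there. At `c` times the quantile it
exceeds 1 for `c < 1` and is at most 1 for `c > 1`; regular variation compares the two points up to
the factor `c ^ α`, and `c → 1`. -/
theorem tendsto_mul_tail_tailQuantile (hT : IsRegVaryingTail α T) (hα : 0 < α) :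
    Tendsto (fun N : ℕ => (N : ℝ) * T (tailQuantile T N)) atTop (𝓝 1) := by
  have ha := hT.tendsto_tailQuantile hα
  have hrat : ∀ c : ℝ, 0 < c → Tendsto (fun N : ℕ => T (tailQuantile T N) /
      T (c * tailQuantile T N)) atTop (𝓝 (c ^ α)) := by
    intro c hc
    have := ((hT.tendsto_ratio c hc).comp ha).inv₀ (by positivity)
    simpa [Function.comp_def, Real.rpow_neg hc.le] using this
  have hcont : Tendsto (fun c : ℝ => c ^ α) (𝓝 1) (𝓝 1) := by
    simpa using (Real.continuousAt_rpow_const 1 α (Or.inl one_ne_zero)).tendsto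
  refine tendsto_order.2 ⟨fun b hb => ?_, fun b hb => ?_⟩
  · obtain ⟨c, ⟨hcb, hc0⟩, hc1⟩ :=
      (((hcont.eventually_const_lt hb).and (eventually_gt_nhds one_pos)).filter_mono
        nhdsWithin_le_nhds |>.and (self_mem_nhdsWithin (a := (1 : ℝ)) (s := Set.Iio 1))).exists
    filter_upwards [(hrat c hc0).eventually_const_lt hcb, ha.eventually_gt_atTop 0,
      eventually_gt_atTop 1] with N h1 h2 h3
    have h4 := hT.lt_of_lt_tailQuantile h3 (u := c * tailQuantile T N)
      (mul_lt_of_lt_one_left h2 hc1)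
    have hN : (0 : ℝ) < N := by positivity
    rw [div_lt_iff₀ hN] at h4
    rw [lt_div_iff₀ (hT.pos _)] at h1
    have h5 : 0 < T (tailQuantile T N) := hT.pos _
    have h6 := hT.pos (c * tailQuantile T N)
    rcases le_or_gt b 0 with hb0 | hb0
    · exact hb0.trans_lt (by positivity)
    calc b < b * (T (c * tailQuantile T N) * N) := lt_mul_of_one_lt_right hb0 h4
      _ = N * (b * T (c * tailQuantile T N)) := by ring
      _ < _ := by gcongr
  · obtain ⟨c, hcb, hc1⟩ := (((hcont.eventually_lt_const hb).filter_mono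
        nhdsWithin_le_nhds).and (self_mem_nhdsWithin (a := (1 : ℝ)) (s := Set.Ioi 1))).exists
    have hc1 : 1 < c := hc1
    filter_upwards [(hrat c (by linarith)).eventually_lt_const hcb, ha.eventually_gt_atTop 0,
      eventually_gt_atTop 1] with N h1 h2 h3
    have h4 := hT.le_of_tailQuantile_lt hα (N := N) (by omega) (u := c * tailQuantile T N)
      (lt_mul_of_one_lt_left h2 hc1)
    have hN : (0 : ℝ) < N := by positivity
    rw [le_div_iff₀ hN] at h4
    rw [div_lt_iff₀ (hT.pos _)] at h1
    calc N * T (tailQuantile T N) < N * (b * T (c * tailQuantile T N)) := by gcongr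
      _ = b * (T (c * tailQuantile T N) * N) := by ring
      _ ≤ b := mul_le_of_le_one_right (by linarith) h4

theorem tendsto_mul_tail (hT : IsRegVaryingTail α T) (hα : 0 < α) {x : ℝ} (hx : 0 < x) :
    Tendsto (fun N : ℕ => (N : ℝ) * T (tailQuantile T N * x)) atTop (𝓝 (x ^ (-α))) := by
  have h := ((hT.tendsto_ratio x hx).comp (hT.tendsto_tailQuantile hα)).mul
    (hT.tendsto_mul_tail_tailQuantile hα)
  rw [mul_one] at h
  refine h.congr fun N => ?_
  have := (hT.pos (tailQuantile T N)).ne'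
  simp only [Function.comp]
  field_simp

/-- Domination for the Laplace integral: Potter's bound handles `u ≤ 1`, monotonicity `u ≥ 1`. With
`β < 1` the bound is integrable at 0. -/
theorem exists_mul_tail_le (hT : IsRegVaryingTail α T) (hα : 0 < α) {β : ℝ} (hαβ : α < β) :
    ∃ C : ℝ, 0 < C ∧ ∀ᶠ N : ℕ in atTop, ∀ u : ℝ, 0 < u →
      (N : ℝ) * T (tailQuantile T N * u) ≤ C * (u ^ (-β) + 1) := by
  obtain ⟨C, x₀, hC, hx₀, h⟩ := hT.exists_potter_bound (hα.trans hαβ) hαβ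
  refine ⟨2 * (C + 1), by positivity, ?_⟩
  filter_upwards [(hT.tendsto_mul_tail_tailQuantile hα).eventually_le_const one_lt_two,
    (hT.tendsto_tailQuantile hα).eventually_ge_atTop x₀] with N h1 h2 u hu
  set a := tailQuantile T N
  have ha : 0 < a := hx₀.trans_le h2
  rcases le_total u 1 with hu1 | hu1
  · have h3 := h a (a * u) h2 (by positivity) (mul_le_of_le_one_right ha.le hu1)
    rw [Real.mul_rpow ha.le hu.le, mul_assoc, mul_left_comm C] at h3
    have h4 := le_of_mul_le_mul_left h3 (by positivity)
    have h5 : T (a * u) ≤ u ^ (-β) * (C * T a) := by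
      rw [Real.rpow_neg hu.le, inv_mul_eq_div, le_div_iff₀ (by positivity)]
      linarith
    calc (N : ℝ) * T (a * u) ≤ N * (u ^ (-β) * (C * T a)) := by gcongr
      _ = (C * u ^ (-β)) * (N * T a) := by ring
      _ ≤ (C * u ^ (-β)) * 2 := by gcongr
      _ ≤ 2 * (C + 1) * (u ^ (-β) + 1) := by
          have : 0 < u ^ (-β) := by positivity
          nlinarith
  · calc (N : ℝ) * T (a * u) ≤ N * T a := by
          gcongr
          exact hT.antitone (le_mul_of_one_le_right ha.le hu1)
      _ ≤ 2 := h1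
      _ ≤ 2 * (C + 1) * (u ^ (-β) + 1) := by
          have : 0 < u ^ (-β) := by positivity
          nlinarith [mul_pos hC this]

end IsRegVaryingTail

/-! ### Laplace transforms in the right half-plane -/

theorem integrableOn_rpow_mul_exp_neg {α r : ℝ} (hα : α < 1) (hr : 0 < r) :
    IntegrableOn (fun u : ℝ => u ^ (-α) * Real.exp (-r * u)) (Set.Ioi 0) := by
  simpa using integrableOn_rpow_mul_exp_neg_mul_rpow (p := 1) (s := -α) (by linarith) one_pos hr

/-- The Laplace transform of `u ↦ u ^ (-α)` on the right half-plane. -/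
theorem integral_exp_neg_mul_mul_rpow {α : ℝ} (hα : α < 1) {z : ℂ} (hz : 0 < z.re) :
    ∫ u in Set.Ioi (0 : ℝ), Complex.exp (-z * u) * ((u ^ (-α) : ℝ) : ℂ) =
      Real.Gamma (1 - α) * z ^ ((α : ℂ) - 1) := by
  -- The integral is the complex moment generating function, at `-z`, of the measure `u ^ (-α) du`.
  -- It is analytic in the left half-plane and agrees with the Gamma integral at negative reals near
  -- -1, so the identity theorem applies.
  set d : ℝ → ℝ≥0∞ := fun u => ENNReal.ofReal (u ^ (-α)) with hd
  set μ : Measure ℝ := (volume.restrict (Set.Ioi 0)).withDensity d with hμ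
  have hdm : Measurable d := by fun_prop
  have hdt : ∀ᵐ u ∂volume.restrict (Set.Ioi (0 : ℝ)), d u < ∞ := .of_forall fun u => by simp [hd]
  have hdr : ∀ u ∈ Set.Ioi (0 : ℝ), (d u).toReal = u ^ (-α) := fun u hu =>
    ENNReal.toReal_ofReal (Real.rpow_nonneg (le_of_lt hu) _)
  have hmgf : ∀ w : ℂ, complexMGF id μ w =
      ∫ u in Set.Ioi (0 : ℝ), Complex.exp (w * u) * ((u ^ (-α) : ℝ) : ℂ) := by
    intro w
    rw [complexMGF, hμ, integral_withDensity_eq_integral_toReal_smul hdm hdt]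
    refine setIntegral_congr_fun measurableSet_Ioi fun u hu => ?_
    simp only [hdr u hu, id, Complex.real_smul]
    ring
  have hset : Set.Iio 0 ⊆ integrableExpSet id μ := by
    intro t ht
    have ht : t < 0 := ht
    change Integrable _ _
    rw [hμ, integrable_withDensity_iff_integrable_smul' hdm hdt]
    refine (integrableOn_rpow_mul_exp_neg hα (neg_pos.2 ht)).congr_fun (fun u hu => ?_)
      measurableSet_Ioi
    simp [hdr u hu]
  have hint : Set.Iio 0 ⊆ interior (integrableExpSet id μ) := interior_maximal hset isOpen_Iio
  have hU : IsPreconnected {w : ℂ | w.re < 0} := (convex_halfSpace_re_lt 0).isPreconnected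
  have h1 : AnalyticOnNhd ℂ (complexMGF id μ) {w : ℂ | w.re < 0} :=
    analyticOnNhd_complexMGF.mono fun w hw => hint hw
  have h2 : AnalyticOnNhd ℂ (fun w : ℂ => Real.Gamma (1 - α) * (-w) ^ ((α : ℂ) - 1))
      {w : ℂ | w.re < 0} := by
    refine DifferentiableOn.analyticOnNhd (fun w hw => ?_)
      (isOpen_lt Complex.continuous_re continuous_const)
    refine (DifferentiableAt.const_mul (differentiableAt_id.neg.cpow_const ?_)
      _).differentiableWithinAt
    exact Or.inl (by simpa using hw)
  have hfreq : ∃ᶠ w in 𝓝[≠] (-1 : ℂ), complexMGF id μ w =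
      Real.Gamma (1 - α) * (-w) ^ ((α : ℂ) - 1) := by
    have hlim : Tendsto (fun t : ℝ => (t : ℂ)) (𝓝[>] (-1)) (𝓝[≠] (-1 : ℂ)) := by
      refine tendsto_nhdsWithin_iff.2 ⟨?_, ?_⟩
      · have := (Complex.continuous_ofReal.tendsto (-1)).mono_left
          (nhdsWithin_le_nhds (s := Set.Ioi (-1)))
        simpa using this
      · filter_upwards [self_mem_nhdsWithin] with t ht
        have ht : -1 < t := ht
        simp only [Set.mem_compl_iff, Set.mem_singleton_iff]
        exact_mod_cast ht.ne'
    refine hlim.frequently (Eventually.frequently ?_)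
    filter_upwards [nhdsWithin_le_nhds (eventually_lt_nhds (show (-1 : ℝ) < 0 by norm_num))]
      with t ht
    rw [hmgf]
    have h3 := Complex.integral_cpow_mul_exp_neg_mul_Ioi (a := 1 - (α : ℂ)) (r := -t)
      (by simpa using hα) (by linarith)
    have h4 : ((1 / (-t : ℝ) : ℂ)) ^ (1 - (α : ℂ)) = (-t : ℂ) ^ ((α : ℂ) - 1) := by
      rw [one_div, ← Complex.ofReal_inv, Complex.ofReal_inv, Complex.inv_cpow, ← Complex.cpow_neg]
      · simp
      · rw [Complex.arg_ofReal_of_nonneg (by linarith)]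
        exact Real.pi_pos.ne
    rw [h4] at h3
    rw [← Complex.Gamma_ofReal, mul_comm, Complex.ofReal_sub, Complex.ofReal_one, ← h3]
    refine setIntegral_congr_fun measurableSet_Ioi fun u hu => ?_
    have hu : (0 : ℝ) < u := hu
    simp only [Complex.ofReal_cpow hu.le]
    rw [mul_comm]
    congr 2
    · push_cast; ring
    · push_cast; ring
  have := AnalyticOnNhd.eqOn_of_preconnected_of_frequently_eq h1 h2 hU
    (by simp) hfreq (show -z ∈ {w : ℂ | w.re < 0} by simpa using hz)
  rw [hmgf] at this
  simpa using this

/-- The Laplace transform of a non-negative random variable in terms of its tail. -/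
theorem one_sub_integral_exp_neg {Ω : Type*} [MeasurableSpace Ω] {P : Measure Ω}
    [IsProbabilityMeasure P] {Y : Ω → ℝ} (hY : AEMeasurable Y P) (hY0 : ∀ᵐ ω ∂P, 0 ≤ Y ω) {z : ℂ}
    (hz : 0 < z.re) :
    1 - ∫ ω, Complex.exp (-z * Y ω) ∂P =
      ∫ u in Set.Ioi (0 : ℝ), z * Complex.exp (-z * u) * (P.real {ω | u ≤ Y ω} : ℂ) := by
  have hz0 : z ≠ 0 := by rintro rfl; simp at hz
  have hint : IntegrableOn (fun u : ℝ => Complex.exp (-z * u)) (Set.Ioi 0) :=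
    integrableOn_exp_mul_complex_Ioi (by simpa using hz) 0
  set Y' := hY.mk Y
  have hYm : Measurable Y' := hY.measurable_mk
  have hYY : Y =ᵐ[P] Y' := hY.ae_eq_mk
  have hY'0 : ∀ᵐ ω ∂P, 0 ≤ Y' ω := by
    filter_upwards [hY0, hYY] with ω h1 h2; rwa [← h2]
  have htail : ∀ u : ℝ, P.real {ω | u ≤ Y ω} = P.real {ω | u ≤ Y' ω} := fun u => by
    refine measureReal_congr ?_
    filter_upwards [hYY] with ω h
    change (u ≤ Y ω) = (u ≤ Y' ω)
    rw [h]
  have hexp : ∫ ω, Complex.exp (-z * Y ω) ∂P = ∫ ω, Complex.exp (-z * Y' ω) ∂P :=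
    integral_congr_ae (by filter_upwards [hYY] with ω h; rw [h])
  simp only [htail, hexp]
  -- Fubini applied to `1 - exp (-z y) = ∫ z exp (-z u) du` over `0 < u ≤ y`.
  set f : Ω → ℝ → ℂ := fun ω u => Set.indicator {p : Ω × ℝ | p.2 ≤ Y' p.1}
    (fun p => z * Complex.exp (-z * p.2)) (ω, u) with hf
  have hmeas : MeasurableSet {p : Ω × ℝ | p.2 ≤ Y' p.1} :=
    measurableSet_le measurable_snd (hYm.comp measurable_fst)
  have hfint : Integrable (Function.uncurry f) (P.prod (volume.restrict (Set.Ioi 0))) := by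
    have : Integrable (fun p : Ω × ℝ => z * Complex.exp (-z * p.2))
        (P.prod (volume.restrict (Set.Ioi 0))) := (hint.const_mul z).comp_snd P
    exact this.indicator hmeas
  have hswap := integral_integral_swap hfint
  have hleft : ∀ᵐ ω ∂P, ∫ u in Set.Ioi (0 : ℝ), f ω u = 1 - Complex.exp (-z * Y' ω) := by
    filter_upwards [hY'0] with ω hω
    have h1 : ∫ u in Set.Ioi (0 : ℝ), f ω u =
        ∫ u in Set.Ioi (0 : ℝ), (Set.Iic (Y' ω)).indicator (fun u : ℝ => z * Complex.exp (-z * u)) u :=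
      rfl
    rw [h1, setIntegral_indicator measurableSet_Iic, Set.Ioi_inter_Iic,
      ← intervalIntegral.integral_of_le hω, intervalIntegral.integral_const_mul,
      integral_exp_mul_complex (neg_ne_zero.2 hz0)]
    simp only [Complex.ofReal_zero, mul_zero, Complex.exp_zero]
    field_simp
    ring
  have hright : ∀ u : ℝ, ∫ ω, f ω u ∂P = z * Complex.exp (-z * u) * (P.real {ω | u ≤ Y' ω} : ℂ) := by
    intro u
    have h1 : ∫ ω, f ω u ∂P =
        ∫ ω, {ω | u ≤ Y' ω}.indicator (fun _ => z * Complex.exp (-z * u)) ω ∂P := rfl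
    rw [h1, integral_indicator_const _ (measurableSet_le measurable_const hYm), Complex.real_smul,
      mul_comm]
  have hbound : Integrable (fun ω => Complex.exp (-z * Y' ω)) P := by
    refine Integrable.of_bound (by fun_prop) 1 ?_
    filter_upwards [hY'0] with ω hω
    rw [Complex.norm_exp]
    simp only [Complex.mul_re, Complex.neg_re, Complex.ofReal_re, Complex.ofReal_im, mul_zero,
      sub_zero, Real.exp_le_one_iff]
    nlinarith
  rw [integral_congr_ae hleft, integral_sub (integrable_const _) hbound] at hswap
  simp only [hright] at hswap
  rw [← hswap]
  simp

namespace IsRegVaryingTail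

variable {α : ℝ} {T : ℝ → ℝ}

/-- Dominated convergence, jointly in `N` and the point near `z`; the joint limit is what later
yields locally uniform convergence. -/
theorem tendsto_integral_exp_neg_mul_tail (hT : IsRegVaryingTail α T) (hα0 : 0 < α) (hα1 : α < 1)
    {z : ℂ} (hz : 0 < z.re) :
    Tendsto (fun p : ℕ × ℂ => ∫ u in Set.Ioi (0 : ℝ), p.2 * Complex.exp (-p.2 * u) *
      ((p.1 * T (tailQuantile T p.1 * u) : ℝ) : ℂ)) (atTop ×ˢ 𝓝 z)
      (𝓝 (Real.Gamma (1 - α) * z ^ (α : ℂ))) := by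
  have hz0 : z ≠ 0 := by rintro rfl; simp at hz
  have hval : Real.Gamma (1 - α) * z ^ (α : ℂ) =
      ∫ u in Set.Ioi (0 : ℝ), z * Complex.exp (-z * u) * ((u ^ (-α) : ℝ) : ℂ) := by
    simp_rw [mul_assoc]
    rw [integral_const_mul, integral_exp_neg_mul_mul_rpow hα1 hz, Complex.cpow_sub _ _ hz0,
      Complex.cpow_one]
    field_simp
  rw [hval]
  obtain ⟨β, hβ0, hβ1⟩ := exists_between hα1
  obtain ⟨C, hC, hdom⟩ := hT.exists_mul_tail_le hα0 hβ0
  set r := z.re / 2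
  have hr : 0 < r := half_pos hz
  have hTm : Measurable T := hT.antitone.measurable
  refine tendsto_integral_filter_of_dominated_convergence
    (fun u => (‖z‖ + 1) * C * (u ^ (-β) * Real.exp (-r * u) + Real.exp (-r * u))) ?_ ?_ ?_ ?_
  · refine .of_forall fun p => Measurable.aestronglyMeasurable ?_
    fun_prop
  · have h1 : ∀ᶠ w in 𝓝 z, ‖w‖ < ‖z‖ + 1 :=
      continuous_norm.continuousAt.eventually_lt_const (lt_add_one ‖z‖)
    have h2 : ∀ᶠ w : ℂ in 𝓝 z, r < w.re :=
      Complex.continuous_re.continuousAt.eventually_const_lt (half_lt_self hz)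
    filter_upwards [hdom.prod_mk (h1.and h2)] with p hp
    obtain ⟨hp1, hp2, hp3⟩ := hp
    refine (ae_restrict_mem measurableSet_Ioi).mono fun u hu => ?_
    have hu : 0 < u := hu
    rw [norm_mul, norm_mul, Complex.norm_exp, Complex.norm_real, Real.norm_of_nonneg
      (by have := (hT.pos (tailQuantile T p.1 * u)).le; positivity)]
    have h3 : (-p.2 * (u : ℂ)).re = -p.2.re * u := by simp
    rw [h3]
    have hub : 0 < u ^ (-β) := by positivity
    calc ‖p.2‖ * Real.exp (-p.2.re * u) * (p.1 * T (tailQuantile T p.1 * u))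
        ≤ (‖z‖ + 1) * Real.exp (-r * u) * (C * (u ^ (-β) + 1)) := by
          refine mul_le_mul ?_ (hp1 u hu)
            (mul_nonneg p.1.cast_nonneg (hT.pos _).le) (by positivity)
          gcongr
      _ = _ := by ring
  · have h1 : IntegrableOn (fun u : ℝ => Real.exp (-r * u)) (Set.Ioi 0) :=
      integrableOn_exp_mul_Ioi (by linarith) 0
    exact ((integrableOn_rpow_mul_exp_neg hβ1 hr).add h1).const_mul _
  · refine (ae_restrict_mem measurableSet_Ioi).mono fun u hu => ?_
    have h1 : Tendsto (fun w : ℂ => w * Complex.exp (-w * u)) (𝓝 z) (𝓝 (z * Complex.exp (-z * u))) :=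
      Continuous.tendsto (by fun_prop) z
    exact (h1.comp tendsto_snd).mul
      ((Complex.continuous_ofReal.tendsto _).comp ((hT.tendsto_mul_tail hα0 hu).comp tendsto_fst))

end IsRegVaryingTail

/-! ### From the Laplace transform to the characteristic function -/

theorem isRegVaryingTail_of_isSlowlyVarying {Ω : Type*} [MeasurableSpace Ω] {P : Measure Ω}
    [IsProbabilityMeasure P] {α : ℝ} {Y : Ω → ℝ}
    (hY0 : ∀ᵐ ω ∂P, 0 ≤ Y ω) {L : ℝ → ℝ} (hL : IsSlowlyVarying L)
    (htail : ∀ u : ℝ, 0 < u → P.real {ω | u ≤ Y ω} = L u / u ^ α) :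
    IsRegVaryingTail α (fun u => P.real {ω | u ≤ Y ω}) := by
  have hanti : Antitone (fun u => P.real {ω | u ≤ Y ω}) := fun u v huv =>
    measureReal_mono fun ω hω => huv.trans hω
  refine ⟨hanti, fun u => ?_, fun u => measureReal_le_one, fun u hu => ?_, fun c hc => ?_⟩
  -- `L` is positive only near infinity; monotonicity of the tail carries positivity back to every
  -- `u`.
  · obtain ⟨v, hv1, hv2, hv3⟩ := (hL.eventually_pos.and
      ((eventually_gt_atTop 0).and (eventually_ge_atTop u))).exists
    refine lt_of_lt_of_le ?_ (hanti hv3)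
    simp only [htail v hv2]
    positivity
  · have : {ω | u ≤ Y ω} =ᵐ[P] Set.univ := by
      rw [eventuallyEq_univ]
      filter_upwards [hY0] with ω hω using hu.trans hω
    simp [measureReal_congr this]
  · have h := (hL.tendsto_ratio c hc).mul_const (c ^ (-α))
    rw [one_mul] at h
    refine h.congr' ?_
    filter_upwards [eventually_gt_atTop 0, hL.eventually_pos] with u hu hLu
    rw [htail u hu, htail (c * u) (by positivity), Real.mul_rpow hc.le hu.le, Real.rpow_neg hc.le]
    field_simp

/-- The exponent of the totally skewed `α`-stable law on the half-line. -/
noncomputable def stableExponent (α s : ℝ) : ℂ := Real.Gamma (1 - α) * (-(s * Complex.I)) ^ (α : ℂ)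

/-- The closed right half-plane meets the branch cut only at 0, where `0 < α` gives continuity. -/
theorem continuousAt_cpow_of_re_nonneg {α : ℝ} (hα : 0 < α) {z : ℂ} (hz : 0 ≤ z.re) :
    ContinuousAt (fun w : ℂ => w ^ (α : ℂ)) z := by
  rcases eq_or_ne z 0 with rfl | h0
  · exact (Complex.continuousAt_cpow_zero_of_re_pos (z := (α : ℂ)) (by simpa using hα)).comp
      (f := fun w : ℂ => (w, (α : ℂ))) (by fun_prop)
  · refine continuousAt_cpow_const ?_
    rw [Complex.mem_slitPlane_iff]
    rcases hz.lt_or_eq with h | h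
    · exact Or.inl h
    · exact Or.inr fun him => h0 (Complex.ext h.symm him)

theorem continuous_stableExponent {α : ℝ} (hα : 0 < α) : Continuous (stableExponent α) := by
  refine continuous_iff_continuousAt.2 fun s => ContinuousAt.mul continuousAt_const ?_
  exact (continuousAt_cpow_of_re_nonneg hα (z := -(s * Complex.I)) (by simp)).comp
    (f := fun s : ℝ => (-(s * Complex.I) : ℂ)) (by fun_prop)

section Limits

variable {Ω : Type*} [MeasurableSpace Ω] {P : Measure Ω} [IsProbabilityMeasure P] {Y : Ω → ℝ}
  {α : ℝ}

theorem norm_exp_mul_le_one {z : ℂ} {y : ℝ} (hz : z.re ≤ 0) (hy : 0 ≤ y) :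
    ‖Complex.exp (z * y)‖ ≤ 1 := by
  rw [Complex.norm_exp]
  simpa using mul_nonpos_of_nonpos_of_nonneg hz hy

theorem integrable_exp_mul_of_re_nonpos (hY : AEMeasurable Y P) (hY0 : ∀ᵐ ω ∂P, 0 ≤ Y ω) {z : ℂ}
    (hz : z.re ≤ 0) : Integrable (fun ω => Complex.exp (z * Y ω)) P :=
  Integrable.of_bound (by fun_prop) 1 (hY0.mono fun _ hω => norm_exp_mul_le_one hz hω)

/-- Pointwise, `|exp (i s Z) (1 - exp (-ε Z))| ≤ 1 - exp (-ε Z)` because `Z ≥ 0`, and the right side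
does not involve `s`. -/
theorem norm_integral_exp_mul_I_sub_le {Z : Ω → ℝ} (hZ : AEMeasurable Z P)
    (hZ0 : ∀ᵐ ω ∂P, 0 ≤ Z ω) {ε : ℝ} (hε : 0 ≤ ε) (s : ℝ) :
    ‖(1 - ∫ ω, Complex.exp (s * Complex.I * (Z ω : ℂ)) ∂P) -
      (1 - ∫ ω, Complex.exp (-(ε - s * Complex.I) * (Z ω : ℂ)) ∂P)‖ ≤
      ‖1 - ∫ ω, Complex.exp (-(ε : ℂ) * (Z ω : ℂ)) ∂P‖ := by
  have i1 := integrable_exp_mul_of_re_nonpos hZ hZ0 (z := s * Complex.I) (by simp)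
  have i2 := integrable_exp_mul_of_re_nonpos hZ hZ0 (z := -(ε - s * Complex.I))
    (by simpa using hε)
  have i3 := integrable_exp_mul_of_re_nonpos hZ hZ0 (z := -(ε : ℂ)) (by simpa using hε)
  have e1 : (1 - ∫ ω, Complex.exp (s * Complex.I * (Z ω : ℂ)) ∂P) -
      (1 - ∫ ω, Complex.exp (-(ε - s * Complex.I) * (Z ω : ℂ)) ∂P) =
      ∫ ω, (Complex.exp (-(ε - s * Complex.I) * (Z ω : ℂ)) -
        Complex.exp (s * Complex.I * (Z ω : ℂ))) ∂P := by
    rw [integral_sub i2 i1]; ring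
  have e2 : 1 - ∫ ω, Complex.exp (-(ε : ℂ) * (Z ω : ℂ)) ∂P =
      ((∫ ω, (1 - Real.exp (-ε * Z ω)) ∂P : ℝ) : ℂ) := by
    rw [← integral_complex_ofReal]
    simp only [Complex.ofReal_sub, Complex.ofReal_one, Complex.ofReal_exp, Complex.ofReal_mul,
      Complex.ofReal_neg]
    rw [integral_sub (integrable_const _) i3]
    simp
  rw [e1, e2, Complex.norm_real]
  refine (norm_integral_le_of_norm_le (g := fun ω => 1 - Real.exp (-ε * Z ω)) ?_ ?_).trans
    (Real.le_norm_self _)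
  · refine (integrable_const _).sub ?_
    simpa [Complex.exp_ofReal_re] using i3.norm.congr (.of_forall fun ω => by
      simp [Complex.norm_exp])
  · filter_upwards [hZ0] with ω hω
    have e3 : Complex.exp (-(ε - s * Complex.I) * (Z ω : ℂ)) =
        Complex.exp (s * Complex.I * (Z ω : ℂ)) * (Real.exp (-ε * Z ω) : ℝ) := by
      rw [Complex.ofReal_exp, ← Complex.exp_add]
      congr 1
      push_cast
      ring
    rw [e3, ← mul_sub_one, norm_mul, norm_sub_rev]
    refine (mul_le_of_le_one_left (norm_nonneg _) (norm_exp_mul_le_one (by simp) hω)).trans ?_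
    rw [← Complex.ofReal_one, ← Complex.ofReal_sub, Complex.norm_real,
      Real.norm_of_nonneg (sub_nonneg.2 (Real.exp_le_one_iff.2 (by nlinarith)))]

theorem tendsto_mul_one_sub_laplace (hY : AEMeasurable Y P) (hY0 : ∀ᵐ ω ∂P, 0 ≤ Y ω)
    (hT : IsRegVaryingTail α (fun u => P.real {ω | u ≤ Y ω})) (hα0 : 0 < α) (hα1 : α < 1)
    {z : ℂ} (hz : 0 < z.re) :
    Tendsto (fun p : ℕ × ℂ => (p.1 : ℂ) *
      (1 - ∫ ω, Complex.exp (-p.2 * ((Y ω / normConst P Y p.1 : ℝ) : ℂ)) ∂P)) (atTop ×ˢ 𝓝 z)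
      (𝓝 (Real.Gamma (1 - α) * z ^ (α : ℂ))) := by
  refine (hT.tendsto_integral_exp_neg_mul_tail hα0 hα1 hz).congr' ?_
  have h1 : ∀ᶠ w : ℂ in 𝓝 z, 0 < w.re :=
    Complex.continuous_re.continuousAt.eventually_const_lt hz
  have h2 : ∀ᶠ N in atTop, 0 < normConst P Y N :=
    (hT.tendsto_tailQuantile hα0).eventually_gt_atTop 0
  filter_upwards [h2.prod_mk h1] with p hp
  obtain ⟨ha, hw⟩ := hp
  rw [one_sub_integral_exp_neg (hY.div_const _)
    (hY0.mono fun ω hω => div_nonneg hω ha.le) hw, ← integral_const_mul]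
  refine integral_congr_ae (.of_forall fun u => ?_)
  have h3 : {ω | u ≤ Y ω / normConst P Y p.1} = {ω | normConst P Y p.1 * u ≤ Y ω} := by
    ext ω
    simp only [Set.mem_ofPred_eq, le_div_iff₀ ha, mul_comm]
  have h4 : tailQuantile (fun u => P.real {ω | u ≤ Y ω}) p.1 = normConst P Y p.1 := rfl
  simp only [h3, h4, Complex.ofReal_mul, Complex.ofReal_natCast]
  ring

theorem tendsto_mul_one_sub_charFun (hY : AEMeasurable Y P) (hY0 : ∀ᵐ ω ∂P, 0 ≤ Y ω)
    (hT : IsRegVaryingTail α (fun u => P.real {ω | u ≤ Y ω})) (hα0 : 0 < α) (hα1 : α < 1) (s : ℝ) :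
    Tendsto (fun p : ℕ × ℝ => (p.1 : ℂ) *
      (1 - ∫ ω, Complex.exp (p.2 * Complex.I * ((Y ω / normConst P Y p.1 : ℝ) : ℂ)) ∂P))
      (atTop ×ˢ 𝓝 s) (𝓝 (stableExponent α s)) := by
  rw [Metric.tendsto_nhds]
  intro η hη
  obtain ⟨Φ, hΦ⟩ : ∃ Φ : ℕ → ℂ → ℂ, Φ = fun (N : ℕ) (w : ℂ) => (N : ℂ) *
      (1 - ∫ ω, Complex.exp (-w * ((Y ω / normConst P Y N : ℝ) : ℂ)) ∂P) := ⟨_, rfl⟩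
  obtain ⟨G, hG⟩ : ∃ G : ℂ → ℂ, G = fun w : ℂ => Real.Gamma (1 - α) * w ^ (α : ℂ) := ⟨_, rfl⟩
  have hlap : ∀ z : ℂ, 0 < z.re → Tendsto (fun p : ℕ × ℂ => Φ p.1 p.2) (atTop ×ˢ 𝓝 z) (𝓝 (G z)) := by
    intro z hz
    rw [hΦ, hG]
    exact tendsto_mul_one_sub_laplace hY hY0 hT hα0 hα1 hz
  have hGc : ∀ z : ℂ, 0 ≤ z.re → ContinuousAt G z := fun z hz => by
    rw [hG]
    exact continuousAt_const.mul (continuousAt_cpow_of_re_nonneg hα0 hz)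
  -- `ε` is fixed before `N` grows: it makes both the damping cost `G ε` and the displacement of `G`
  -- off the imaginary axis small.
  obtain ⟨ε, ⟨h1, h2⟩, hε⟩ : ∃ ε : ℝ, (‖G ε‖ < η / 3 ∧
      dist (G (ε - s * Complex.I)) (G (-(s * Complex.I))) < η / 3) ∧ ε ∈ Set.Ioi (0 : ℝ) := by
    have e1 : Tendsto (fun ε : ℝ => ‖G ε‖) (𝓝 0) (𝓝 0) := by
      have : ContinuousAt (fun ε : ℝ => G ε) 0 :=
        (hGc 0 le_rfl).comp_of_eq (f := fun ε : ℝ => (ε : ℂ)) (by fun_prop) (by simp)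
      have h0 : ‖G (0 : ℝ)‖ = 0 := by simp [hG, hα0.ne']
      simpa only [h0] using this.norm.tendsto
    have e2 : Tendsto (fun ε : ℝ => G (ε - s * Complex.I)) (𝓝 0) (𝓝 (G (-(s * Complex.I)))) := by
      have : ContinuousAt (fun ε : ℝ => G (ε - s * Complex.I)) 0 :=
        (hGc (-(s * Complex.I)) (by simp)).comp_of_eq
          (f := fun ε : ℝ => (ε - s * Complex.I : ℂ)) (by fun_prop) (by simp)
      simpa using this.tendsto
    exact ((((e1.eventually_lt_const (by positivity)).and
      (Metric.tendsto_nhds.1 e2 (η / 3) (by positivity))).filter_mono nhdsWithin_le_nhds).and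
      (self_mem_nhdsWithin (a := (0 : ℝ)) (s := Set.Ioi 0))).exists
  have hε : 0 < ε := hε
  have hΦ1 : Tendsto (fun N => ‖Φ N ε‖) atTop (𝓝 ‖G ε‖) := by
    have hc : Tendsto (fun N : ℕ => (N, (ε : ℂ))) atTop (atTop ×ˢ 𝓝 (ε : ℂ)) :=
      tendsto_id.prodMk tendsto_const_nhds
    exact (Tendsto.comp (hlap ε (by simpa using hε)) hc).norm
  have hΦ2 : Tendsto (fun p : ℕ × ℝ => Φ p.1 (ε - p.2 * Complex.I)) (atTop ×ˢ 𝓝 s)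
      (𝓝 (G (ε - s * Complex.I))) := by
    have hc : Tendsto (fun s : ℝ => (ε - s * Complex.I : ℂ)) (𝓝 s) (𝓝 (ε - s * Complex.I)) :=
      Continuous.tendsto (by fun_prop) s
    have hc' : Tendsto (fun p : ℕ × ℝ => (p.1, (ε - p.2 * Complex.I : ℂ))) (atTop ×ˢ 𝓝 s)
        (atTop ×ˢ 𝓝 (ε - s * Complex.I : ℂ)) := tendsto_fst.prodMk (hc.comp tendsto_snd)
    exact Tendsto.comp (hlap _ (by simpa using hε)) hc'
  have ha : ∀ᶠ N in atTop, 0 < normConst P Y N :=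
    (hT.tendsto_tailQuantile hα0).eventually_gt_atTop 0
  filter_upwards [((hΦ1.eventually_lt_const h1).and ha).prod_inl (𝓝 s),
    Metric.tendsto_nhds.1 hΦ2 (η / 3) (by positivity)] with p hp hp3
  obtain ⟨hp1, hp2⟩ := hp
  set Z : Ω → ℝ := fun ω => Y ω / normConst P Y p.1
  have hZ : AEMeasurable Z P := hY.div_const _
  have hZ0 : ∀ᵐ ω ∂P, 0 ≤ Z ω := hY0.mono fun ω hω => div_nonneg hω hp2.le
  have hdiff : ‖(p.1 : ℂ) * (1 - ∫ ω, Complex.exp (p.2 * Complex.I * (Z ω : ℂ)) ∂P) -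
      Φ p.1 (ε - p.2 * Complex.I)‖ ≤ ‖Φ p.1 ε‖ := by
    simp only [hΦ, ← mul_sub, norm_mul]
    gcongr
    exact norm_integral_exp_mul_I_sub_le hZ hZ0 hε.le p.2
  have hGs : stableExponent α s = G (-(s * Complex.I)) := by rw [hG]; rfl
  rw [hGs]
  calc _ ≤ dist ((p.1 : ℂ) * (1 - ∫ ω, Complex.exp (p.2 * Complex.I * (Z ω : ℂ)) ∂P))
        (Φ p.1 (ε - p.2 * Complex.I)) + dist (Φ p.1 (ε - p.2 * Complex.I)) (G (ε - s * Complex.I))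
        + dist (G (ε - s * Complex.I)) (G (-(s * Complex.I))) := dist_triangle4 _ _ _ _
    _ < η / 3 + η / 3 + η / 3 := by
        rw [dist_eq_norm]
        exact add_lt_add (add_lt_add (hdiff.trans_lt hp1) hp3) h2
    _ = η := by ring

end Limits

/-! ### Products over null arrays -/

theorem Finset.norm_prod_sub_prod_le_sum {ι : Type*} (s : Finset ι) {f g : ι → ℂ}
    (hf : ∀ i ∈ s, ‖f i‖ ≤ 1) (hg : ∀ i ∈ s, ‖g i‖ ≤ 1) :
    ‖∏ i ∈ s, f i - ∏ i ∈ s, g i‖ ≤ ∑ i ∈ s, ‖f i - g i‖ := by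
  classical
  induction s using Finset.induction_on with
  | empty => simp
  | insert a s ha ih =>
    rw [Finset.prod_insert ha, Finset.prod_insert ha, Finset.sum_insert ha]
    have ih' := ih (fun i hi => hf i (Finset.mem_insert_of_mem hi))
      fun i hi => hg i (Finset.mem_insert_of_mem hi)
    have hp : ‖∏ i ∈ s, f i‖ ≤ 1 := (Finset.norm_prod_le _ _).trans
      (Finset.prod_le_one (fun _ _ => norm_nonneg _)
        fun i hi => hf i (Finset.mem_insert_of_mem hi))
    have hga := hg a (Finset.mem_insert_self a s)
    calc ‖f a * ∏ i ∈ s, f i - g a * ∏ i ∈ s, g i‖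
        = ‖(f a - g a) * ∏ i ∈ s, f i + g a * (∏ i ∈ s, f i - ∏ i ∈ s, g i)‖ := by ring_nf
      _ ≤ ‖f a - g a‖ * ‖∏ i ∈ s, f i‖ + ‖g a‖ * ‖∏ i ∈ s, f i - ∏ i ∈ s, g i‖ := by
          rw [← norm_mul, ← norm_mul]; exact norm_add_le _ _
      _ ≤ ‖f a - g a‖ * 1 + 1 * ∑ i ∈ s, ‖f i - g i‖ := by gcongr
      _ = _ := by ring

/-- Products over the rows of a null array converge to the exponential of the limit of the row
sums. -/
theorem tendsto_prod_one_sub_of_tendsto_sum {c : (N : ℕ) → Fin N → ℂ} {K : ℝ} {S : ℂ}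
    (hc1 : ∀ᶠ N in atTop, ∀ k, ‖1 - c N k‖ ≤ 1) (hcK : ∀ᶠ N : ℕ in atTop, ∀ k, N * ‖c N k‖ ≤ K)
    (hS : Tendsto (fun N => ∑ k, c N k) atTop (𝓝 S)) :
    Tendsto (fun N => ∏ k, (1 - c N k)) atTop (𝓝 (Complex.exp (-S))) := by
  have hexp : Tendsto (fun N => ∏ k, Complex.exp (-c N k)) atTop (𝓝 (Complex.exp (-S))) := by
    simp_rw [← Complex.exp_sum, Finset.sum_neg_distrib]
    exact (Complex.continuous_exp.tendsto _).comp hS.neg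
  have hK0 : Tendsto (fun N : ℕ => K ^ 2 / (N : ℝ)) atTop (𝓝 0) :=
    tendsto_const_div_atTop_nhds_zero_nat _
  have hsmall : ∀ᶠ N : ℕ in atTop, K ≤ N := tendsto_natCast_atTop_atTop.eventually_ge_atTop K
  have hdiff : Tendsto (fun N => ∏ k, (1 - c N k) - ∏ k, Complex.exp (-c N k)) atTop (𝓝 0) := by
    refine squeeze_zero_norm' ?_ hK0
    filter_upwards [hc1, hcK, hsmall, eventually_gt_atTop 0] with N h1 h2 h3 hN
    have hN : (0 : ℝ) < N := by exact_mod_cast hN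
    have hck : ∀ k, ‖c N k‖ ≤ K / N := fun k => by
      rw [le_div_iff₀ hN, mul_comm]; exact h2 k
    -- `‖1 - c‖ ≤ 1` forces `Re c ≥ 0`, hence `‖exp (-c)‖ ≤ 1`, as the product comparison requires.
    have hre : ∀ k, 0 ≤ (c N k).re := fun k => by
      have := (Complex.re_le_norm _).trans (h1 k)
      simpa using this
    have hterm : ∀ k, ‖1 - c N k - Complex.exp (-c N k)‖ ≤ (K / N) ^ 2 := fun k => by
      have h4 : ‖-c N k‖ ≤ 1 := by
        rw [norm_neg]; exact (hck k).trans ((div_le_one hN).2 h3)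
      have h5 := Complex.norm_exp_sub_one_sub_id_le h4
      rw [norm_neg] at h5
      rw [norm_sub_rev]
      calc _ = ‖Complex.exp (-c N k) - 1 - -c N k‖ := by congr 1; ring
        _ ≤ ‖c N k‖ ^ 2 := h5
        _ ≤ _ := by gcongr; exact hck k
    refine (Finset.norm_prod_sub_prod_le_sum _ (fun k _ => h1 k) fun k _ => ?_).trans
      ((Finset.sum_le_sum fun k _ => hterm k).trans_eq ?_)
    · rw [Complex.norm_exp]
      simpa using hre k
    · simp only [Finset.sum_const, Finset.card_univ, Fintype.card_fin, nsmul_eq_mul]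
      field_simp
  simpa using hdiff.add hexp

/-! ### Averages over the bounded array -/

theorem integral_empiricalMeasure {N : ℕ} (g : Fin N → ℂ) (f : ℂ → ℂ) :
    ∫ z, f z ∂(empiricalMeasure g : Measure ℂ) = (N : ℂ)⁻¹ * ∑ k, f (g k) := by
  have h : (empiricalMeasure g : Measure ℂ) =
      (N : ℝ≥0)⁻¹ • ∑ k : Fin N, Measure.dirac (g k) := by
    rw [empiricalMeasure, FiniteMeasure.toMeasure_smul, FiniteMeasure.toMeasure_sum]
    rfl
  rw [h, integral_smul_nnreal_measure, integral_finsetSum_measure fun k _ => integrable_dirac (by simp)]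
  simp [integral_dirac, NNReal.smul_def]

section Empirical

variable {G : (N : ℕ) → Fin N → ℂ} {ν : ProbabilityMeasure ℂ} {M : ℝ}

theorem tendsto_average_of_continuous_bounded
    (hν : Tendsto (fun N : ℕ => empiricalMeasure (G N)) atTop (𝓝 ν.toFiniteMeasure))
    {f : ℂ → ℂ} (hf : Continuous f) {B : ℝ} (hB : ∀ z, ‖f z‖ ≤ B) :
    Tendsto (fun N : ℕ => (N : ℂ)⁻¹ * ∑ k, f (G N k)) atTop (𝓝 (∫ z, f z ∂(ν : Measure ℂ))) := by
  have := (FiniteMeasure.tendsto_iff_forall_integral_rclike_tendsto ℂ).1 hν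
    (BoundedContinuousFunction.ofNormedAddCommGroup f hf B hB)
  refine this.congr fun N => ?_
  exact integral_empiricalMeasure (G N) f

/-- A bounded continuous function vanishing exactly on the ball has zero average over every row,
hence zero integral against `ν`. -/
theorem ae_norm_le_of_tendsto_empiricalMeasure (hG : ∀ (N : ℕ) (k : Fin N), ‖G N k‖ ≤ M)
    (hν : Tendsto (fun N : ℕ => empiricalMeasure (G N)) atTop (𝓝 ν.toFiniteMeasure)) :
    ∀ᵐ z ∂(ν : Measure ℂ), ‖z‖ ≤ M := by
  have hf : Continuous fun z : ℂ => min 1 (max 0 (‖z‖ - M)) := by fun_prop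
  have hf0 : ∀ z : ℂ, 0 ≤ min 1 (max 0 (‖z‖ - M)) := fun z => by positivity
  have hf1 : ∀ z : ℂ, ‖min 1 (max 0 (‖z‖ - M))‖ ≤ 1 := fun z => by
    rw [Real.norm_of_nonneg (hf0 z)]; exact min_le_left _ _
  have h1 := tendsto_average_of_continuous_bounded hν
    (f := fun z => ((min 1 (max 0 (‖z‖ - M)) : ℝ) : ℂ)) (by fun_prop) (B := 1)
    (fun z => by rw [Complex.norm_real]; exact hf1 z)
  have h2 : ∀ N : ℕ, (N : ℂ)⁻¹ * ∑ k, ((min 1 (max 0 (‖G N k‖ - M)) : ℝ) : ℂ) = 0 := fun N => by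
    rw [Finset.sum_eq_zero fun k _ => ?_, mul_zero]
    rw [max_eq_left (sub_nonpos.2 (hG N k)), min_eq_right zero_le_one, Complex.ofReal_zero]
  simp only [h2] at h1
  have h3 := tendsto_nhds_unique h1 tendsto_const_nhds
  rw [integral_complex_ofReal, Complex.ofReal_eq_zero, integral_eq_zero_iff_of_nonneg hf0
    (Integrable.of_bound hf.aestronglyMeasurable 1 (.of_forall hf1))] at h3
  filter_upwards [h3] with z hz
  by_contra! h
  have : 0 < min 1 (max 0 (‖z‖ - M)) := lt_min one_pos (lt_max_of_lt_right (sub_pos.2 h))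
  exact this.ne' hz

/-- Averages over a bounded array, of functions that converge uniformly on bounded sets. -/
theorem tendsto_average_of_tendstoUniformlyOn (hG : ∀ (N : ℕ) (k : Fin N), ‖G N k‖ ≤ M)
    (hν : Tendsto (fun N : ℕ => empiricalMeasure (G N)) atTop (𝓝 ν.toFiniteMeasure))
    {f : ℂ → ℂ} (hf : Continuous f) {F : ℕ → ℂ → ℂ}
    (hF : TendstoUniformlyOn F f atTop (Metric.closedBall 0 M)) :
    Tendsto (fun N : ℕ => (N : ℂ)⁻¹ * ∑ k, F N (G N k)) atTop
      (𝓝 (∫ z, f z ∂(ν : Measure ℂ))) := by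
  -- The cutoff makes `f` a bounded test function; it equals 1 at the array points and `ν`-almost
  -- everywhere.
  set χ : ℂ → ℝ := fun z => max 0 (min 1 (M + 1 - ‖z‖)) with hχ
  have hχc : Continuous χ := by fun_prop
  have hχ1 : ∀ z, ‖z‖ ≤ M → χ z = 1 := fun z hz => by
    simp only [hχ]
    rw [min_eq_left (by linarith), max_eq_right zero_le_one]
  have hχ0 : ∀ z, M + 1 ≤ ‖z‖ → χ z = 0 := fun z hz => by
    simp only [hχ]
    rw [max_eq_left ((min_le_right _ _).trans (by linarith))]
  have hχn : ∀ z, ‖χ z‖ ≤ 1 := fun z => by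
    rw [Real.norm_of_nonneg (le_max_left _ _)]
    exact max_le zero_le_one (min_le_left _ _)
  obtain ⟨B, hB⟩ := (isCompact_closedBall (0 : ℂ) (M + 1)).exists_bound_of_continuousOn
    hf.continuousOn
  have hlim := tendsto_average_of_continuous_bounded hν (f := fun z => χ z * f z)
    (by fun_prop) (B := max B 0) (fun z => by
      rcases le_total (M + 1) ‖z‖ with h | h
      · simp [hχ0 z h]
      · rw [norm_mul, Complex.norm_real]
        exact (mul_le_of_le_one_left (norm_nonneg _) (hχn z)).trans
          ((hB z (by simpa using h)).trans (le_max_left _ _)))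
  have hint : ∫ z, χ z * f z ∂(ν : Measure ℂ) = ∫ z, f z ∂(ν : Measure ℂ) := by
    refine integral_congr_ae ?_
    filter_upwards [ae_norm_le_of_tendsto_empiricalMeasure hG hν] with z hz
    simp [hχ1 z hz]
  rw [hint] at hlim
  have hdiff : Tendsto (fun N : ℕ => (N : ℂ)⁻¹ * ∑ k, F N (G N k) -
      (N : ℂ)⁻¹ * ∑ k, χ (G N k) * f (G N k)) atTop (𝓝 0) := by
    rw [Metric.tendsto_nhds]
    intro ε hε
    filter_upwards [Metric.tendstoUniformlyOn_iff.1 hF (ε / 2) (half_pos hε),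
      eventually_gt_atTop 0] with N hN hN0
    have hN0 : (0 : ℝ) < N := by exact_mod_cast hN0
    rw [dist_zero_right, ← mul_sub, ← Finset.sum_sub_distrib, norm_mul, norm_inv,
      Complex.norm_natCast]
    calc (N : ℝ)⁻¹ * ‖∑ k, (F N (G N k) - χ (G N k) * f (G N k))‖
        ≤ (N : ℝ)⁻¹ * ∑ _k : Fin N, ε / 2 := by
          gcongr
          refine norm_sum_le_of_le _ fun k _ => ?_
          rw [hχ1 _ (hG N k), Complex.ofReal_one, one_mul, ← dist_eq_norm, dist_comm]
          exact (hN _ (by simpa using hG N k)).le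
      _ = ε / 2 := by simp; field_simp
      _ < ε := half_lt_self hε
  simpa using hdiff.add hlim

end Empirical

/-! ### Continuity theorem and spectral form of the exponent -/

/-- The Lévy continuity theorem, in the form that produces the limit. -/
theorem exists_tendsto_of_tendsto_charFun {E : Type*} [NormedAddCommGroup E]
    [InnerProductSpace ℝ E] [FiniteDimensional ℝ E] [MeasurableSpace E] [BorelSpace E]
    {μ : ℕ → ProbabilityMeasure E} {f : E → ℂ} (hf : ContinuousAt f 0)
    (h : ∀ t, Tendsto (fun n => charFun (μ n : Measure E) t) atTop (𝓝 (f t))) :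
    ∃ Q : ProbabilityMeasure E, (∀ t, charFun (Q : Measure E) t = f t) ∧
      Tendsto μ atTop (𝓝 Q) := by
  -- Continuity of `f` at 0 gives tightness; Prokhorov's theorem then supplies a subsequential
  -- limit, whose characteristic function must be `f`.
  have htight := isTightMeasureSet_of_tendsto_charFun hf h
  have hcomp : IsCompact (closure (Set.range μ)) := by
    refine isCompact_closure_of_isTightMeasureSet (htight.subset ?_)
    rintro _ ⟨_, ⟨n, rfl⟩, rfl⟩
    exact ⟨n, rfl⟩
  obtain ⟨Q, -, φ, hφ, hQ⟩ := hcomp.tendsto_subseq fun n => subset_closure (Set.mem_range_self n)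
  have hch : ∀ t, charFun (Q : Measure E) t = f t := fun t =>
    tendsto_nhds_unique (ProbabilityMeasure.tendsto_iff_tendsto_charFun.1 hQ t)
      ((h t).comp hφ.tendsto_atTop)
  exact ⟨Q, hch, ProbabilityMeasure.tendsto_iff_tendsto_charFun.2 fun t => by
    rw [hch]; exact h t⟩

/-- For `s ≠ 0`, `-i s` has modulus `|s|` and argument `-sign(s) π / 2`. Factoring the cosine out of
the power leaves the tangent, and `Γ(2 - α) = (1 - α) Γ(1 - α)` matches the constants. -/
theorem stableExponent_eq {α : ℝ} (hα0 : 0 < α) (hα1 : α < 1) (s : ℝ) :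
    stableExponent α s = ((stableConst α)⁻¹ : ℝ) * (((|s| ^ α : ℝ) : ℂ) *
      (1 - Complex.I * ((Real.sign s * Real.tan (Real.pi * α / 2) : ℝ) : ℂ))) := by
  have hcos : Real.cos (Real.pi * α / 2) ≠ 0 := by
    refine (Real.cos_pos_of_mem_Ioo ⟨?_, ?_⟩).ne' <;> nlinarith [Real.pi_pos]
  have hconst : (stableConst α)⁻¹ = Real.Gamma (1 - α) * Real.cos (Real.pi * α / 2) := by
    have h1 : (1 - α) ≠ 0 := by linarith
    rw [stableConst, inv_inv, show 2 - α = (1 - α) + 1 by ring, Real.Gamma_add_one h1]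
    field_simp
  rcases eq_or_ne s 0 with rfl | hs
  · simp [stableExponent, hα0.ne', Real.zero_rpow hα0.ne']
  have hpow : ∀ r θ : ℝ, ∀ w : ℂ, 0 < r → w ≠ 0 → Complex.log w = θ * Complex.I →
      ((r : ℂ) * w) ^ (α : ℂ) = ((r ^ α : ℝ) : ℂ) *
        (Real.cos (θ * α) + Real.sin (θ * α) * Complex.I) := by
    intro r θ w hr hw hlog
    rw [Complex.cpow_def_of_ne_zero (mul_ne_zero (by exact_mod_cast hr.ne') hw),
      Complex.log_ofReal_mul hr hw, hlog, Real.rpow_def_of_pos hr, Complex.ofReal_exp,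
      Complex.ofReal_cos, Complex.ofReal_sin, ← Complex.exp_mul_I, ← Complex.exp_add]
    congr 1
    push_cast
    ring
  rw [stableExponent, hconst, Real.tan_eq_sin_div_cos]
  have hcos' : (Real.cos (Real.pi * α / 2) : ℂ) ≠ 0 := by exact_mod_cast hcos
  rcases hs.lt_or_gt with h | h
  · have e : -((s : ℂ) * Complex.I) = ((-s : ℝ) : ℂ) * Complex.I := by push_cast; ring
    rw [e, hpow (-s) (Real.pi / 2) Complex.I (by linarith) Complex.I_ne_zero
      (by rw [Complex.log_I]; push_cast; ring), Real.sign_of_neg h, abs_of_neg h,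
      show Real.pi / 2 * α = Real.pi * α / 2 by ring]
    generalize Real.cos (Real.pi * α / 2) = c at hcos' ⊢
    generalize Real.sin (Real.pi * α / 2) = d
    push_cast
    field_simp
    ring
  · have e : -((s : ℂ) * Complex.I) = (s : ℂ) * (-Complex.I) := by ring
    rw [e, hpow s (-(Real.pi / 2)) (-Complex.I) h (neg_ne_zero.2 Complex.I_ne_zero)
      (by rw [Complex.log_neg_I]; push_cast; ring), Real.sign_of_pos h, abs_of_pos h,
      show -(Real.pi / 2) * α = -(Real.pi * α / 2) by ring, Real.cos_neg, Real.sin_neg]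
    generalize Real.cos (Real.pi * α / 2) = c at hcos' ⊢
    generalize Real.sin (Real.pi * α / 2) = d
    push_cast
    field_simp
    ring

theorem stableConst_inv_nonneg {α : ℝ} (hα0 : 0 < α) (hα1 : α < 1) : 0 ≤ (stableConst α)⁻¹ := by
  rw [stableConst, inv_inv]
  have hcos : 0 ≤ Real.cos (Real.pi * α / 2) := by
    refine (Real.cos_pos_of_mem_Ioo ⟨?_, ?_⟩).le <;> nlinarith [Real.pi_pos]
  have := Real.Gamma_pos_of_pos (show 0 < 2 - α by linarith)
  have : 0 < 1 - α := by linarith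
  positivity

theorem isFiniteMeasure_spectralMeasure {α M : ℝ} (hα0 : 0 < α) {ν : Measure ℂ}
    [IsFiniteMeasure ν] (hM : ∀ᵐ z ∂ν, ‖z‖ ≤ M) : IsFiniteMeasure (spectralMeasure α ν) := by
  have h : IsFiniteMeasure (ν.withDensity fun z =>
      ENNReal.ofReal ((stableConst α)⁻¹ * ‖z‖ ^ α)) := by
    refine isFiniteMeasure_withDensity_ofReal (Integrable.of_bound
      (Measurable.aestronglyMeasurable (by fun_prop)) (‖(stableConst α)⁻¹‖ * M ^ α) ?_).2
    filter_upwards [hM] with z hz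
    rw [norm_mul, Real.norm_of_nonneg (Real.rpow_nonneg (norm_nonneg z) _)]
    gcongr
  exact Measure.isFiniteMeasure_map _ _

/-- Since `⟨t, z⟩ = |z| ⟨t, z / |z|⟩`, the sign depends only on the direction of `z`, and the
density absorbs `|z| ^ α`. At `z = 0` both sides vanish. -/
theorem integral_spectralMeasure {α : ℝ} (hα0 : 0 < α) (hα1 : α < 1) (ν : Measure ℂ) (t : ℂ) :
    ∫ s : Metric.sphere (0 : ℂ) 1, ((|inner ℝ t (s : ℂ)| ^ α : ℝ) : ℂ) *
        (1 - Complex.I * ((Real.sign (inner ℝ t (s : ℂ)) * Real.tan (Real.pi * α / 2) : ℝ) : ℂ))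
        ∂(spectralMeasure α ν) = ∫ z, stableExponent α (inner ℝ t z) ∂ν := by
  have hmsign : Measurable Real.sign := by
    unfold Real.sign
    exact Measurable.ite measurableSet_Iio measurable_const
      (Measurable.ite measurableSet_Ioi measurable_const measurable_const)
  have hm : Measurable fun s : Metric.sphere (0 : ℂ) 1 => ((|inner ℝ t (s : ℂ)| ^ α : ℝ) : ℂ) *
      (1 - Complex.I * ((Real.sign (inner ℝ t (s : ℂ)) * Real.tan (Real.pi * α / 2) : ℝ) : ℂ)) := by
    have h1 : Measurable fun s : Metric.sphere (0 : ℂ) 1 => inner ℝ t (s : ℂ) := by fun_prop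
    have h2 := hmsign.comp h1
    simp only [Function.comp_def] at h2
    fun_prop
  rw [spectralMeasure, integral_map measurable_radialProj.aemeasurable hm.aestronglyMeasurable,
    integral_withDensity_eq_integral_toReal_smul (by fun_prop) (.of_forall fun z => by simp)]
  refine integral_congr_ae (.of_forall fun z => ?_)
  have hC := stableConst_inv_nonneg hα0 hα1
  simp only [stableExponent_eq hα0 hα1]
  rw [ENNReal.toReal_ofReal (by positivity), Complex.real_smul]
  rcases eq_or_ne z 0 with rfl | hz
  · simp [Real.zero_rpow hα0.ne']
  have hz0 : 0 < ‖z‖ := norm_pos_iff.2 hz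
  have hproj : inner ℝ t z = ‖z‖ * inner ℝ t (radialProj z : ℂ) := by
    have hz0' : (‖z‖ : ℂ) ≠ 0 := by exact_mod_cast hz0.ne'
    have : z = ‖z‖ • (radialProj z : ℂ) := by
      simp only [radialProj, hz, dite_false, Complex.real_smul]
      field_simp
    conv_lhs => rw [this, inner_smul_right]
  have hsign : ∀ x : ℝ, Real.sign (‖z‖ * x) = Real.sign x := fun x => by
    rcases lt_trichotomy x 0 with h | h | h
    · rw [Real.sign_of_neg h, Real.sign_of_neg (mul_neg_of_pos_of_neg hz0 h)]
    · rw [h, mul_zero]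
    · rw [Real.sign_of_pos h, Real.sign_of_pos (mul_pos hz0 h)]
  rw [hproj, hsign, abs_mul, abs_of_pos hz0, Real.mul_rpow hz0.le (abs_nonneg _)]
  push_cast
  ring

/-! ### Characteristic functions of the sums and conclusion -/

theorem charFun_map_normalizedSum {Ω : Type*} [MeasurableSpace Ω] {P : Measure Ω}
    [IsProbabilityMeasure P] {X : ℕ → Ω → ℝ} (hX : ∀ k, AEMeasurable (X k) P)
    (hXindep : iIndepFun X P) (hXident : ∀ k, IdentDistrib (X k) (X 0) P P) {N : ℕ}
    (g : Fin N → ℂ) (t : ℂ) :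
    charFun (P.map (normalizedSum P X g)) t =
      ∏ k, ∫ ω, Complex.exp ((inner ℝ t (g k) : ℝ) * Complex.I *
        ((X 0 ω / normConst P (X 0) N : ℝ) : ℂ)) ∂P := by
  have hm : AEMeasurable (normalizedSum P X g) P := by
    unfold normalizedSum
    fun_prop
  rw [charFun_apply, integral_map hm (by fun_prop)]
  set a := normConst P (X 0) N
  have hinner : ∀ ω, inner ℝ (normalizedSum P X g ω) t =
      ∑ k : Fin N, inner ℝ t (g k) * (X k ω / a) := by
    intro ω
    have h1 : normalizedSum P X g ω = ∑ k : Fin N, (X k ω / a) • g k := by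
      simp only [normalizedSum, Finset.mul_sum, Complex.real_smul]
      refine Finset.sum_congr rfl fun k _ => ?_
      push_cast
      ring
    rw [h1, sum_inner]
    refine Finset.sum_congr rfl fun k _ => ?_
    rw [real_inner_smul_left, real_inner_comm, mul_comm]
  have hexp : ∀ ω, Complex.exp ((inner ℝ (normalizedSum P X g ω) t : ℝ) * Complex.I) =
      ∏ k : Fin N, (fun x : ℝ => Complex.exp ((inner ℝ t (g k) : ℝ) * Complex.I * ((x / a : ℝ) : ℂ)))
        (X k ω) := by
    intro ω
    rw [hinner, ← Complex.exp_sum, Complex.ofReal_sum, Finset.sum_mul]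
    congr 1
    refine Finset.sum_congr rfl fun k _ => ?_
    push_cast
    ring
  simp only [hexp]
  have hind : iIndepFun (fun k : Fin N => X k) P := hXindep.precomp Fin.val_injective
  rw [hind.integral_fun_prod_comp (f := fun k (x : ℝ) =>
    Complex.exp ((inner ℝ t (g k) : ℝ) * Complex.I * ((x / a : ℝ) : ℂ))) (fun k => hX k)
    (fun k => by fun_prop)]
  refine Finset.prod_congr rfl fun k _ => ?_
  exact ((hXident k).comp (u := fun x : ℝ =>
    Complex.exp ((inner ℝ t (g k) : ℝ) * Complex.I * ((x / a : ℝ) : ℂ))) (by fun_prop)).integral_eq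

theorem tendsto_charFun_normalizedSum {Ω : Type*} [MeasurableSpace Ω] {P : Measure Ω}
    [IsProbabilityMeasure P] {α : ℝ} (hα0 : 0 < α) (hα1 : α < 1) {X : ℕ → Ω → ℝ}
    (hX : ∀ k, AEMeasurable (X k) P) (hXindep : iIndepFun X P)
    (hXident : ∀ k, IdentDistrib (X k) (X 0) P P) (hX0 : ∀ᵐ ω ∂P, 0 ≤ X 0 ω)
    (hT : IsRegVaryingTail α (fun u => P.real {ω | u ≤ X 0 ω}))
    {G : (N : ℕ) → Fin N → ℂ} {M : ℝ} (hG : ∀ (N : ℕ) (k : Fin N), ‖G N k‖ ≤ M)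
    {ν : ProbabilityMeasure ℂ}
    (hν : Tendsto (fun N : ℕ => empiricalMeasure (G N)) atTop (𝓝 ν.toFiniteMeasure)) (t : ℂ) :
    Tendsto (fun N : ℕ => charFun (P.map (normalizedSum P X (G N))) t) atTop
      (𝓝 (Complex.exp (-∫ z, stableExponent α (inner ℝ t z) ∂(ν : Measure ℂ)))) := by
  obtain ⟨Φ, hΦ⟩ : ∃ Φ : ℕ → ℝ → ℂ, Φ = fun (N : ℕ) (s : ℝ) => (N : ℂ) *
      (1 - ∫ ω, Complex.exp (s * Complex.I * ((X 0 ω / normConst P (X 0) N : ℝ) : ℂ)) ∂P) :=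
    ⟨_, rfl⟩
  have hψ := continuous_stableExponent hα0
  have hloc : TendstoLocallyUniformly Φ (stableExponent α) atTop := by
    rw [tendstoLocallyUniformly_iff_forall_tendsto]
    intro s
    have h1 : Tendsto (fun p : ℕ × ℝ => Φ p.1 p.2) (atTop ×ˢ 𝓝 s) (𝓝 (stableExponent α s)) := by
      rw [hΦ]
      exact tendsto_mul_one_sub_charFun (hX 0) hX0 hT hα0 hα1 s
    have h2 : Tendsto (fun p : ℕ × ℝ => stableExponent α p.2) (atTop ×ˢ 𝓝 s)
        (𝓝 (stableExponent α s)) := (hψ.tendsto s).comp tendsto_snd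
    exact (h2.prodMk_nhds h1).mono_right (nhds_le_uniformity _)
  have hcont : Continuous fun z : ℂ => inner ℝ t z := by fun_prop
  have hunif : TendstoUniformlyOn (fun N (z : ℂ) => Φ N (inner ℝ t z))
      (fun z => stableExponent α (inner ℝ t z)) atTop (Metric.closedBall 0 M) :=
    (tendstoLocallyUniformlyOn_iff_tendstoUniformlyOn_of_compact (isCompact_closedBall 0 M)).1
      (hloc.comp _ hcont).tendstoLocallyUniformlyOn
  have hsum := tendsto_average_of_tendstoUniformlyOn hG hν (hψ.comp hcont) hunif
  obtain ⟨c, hc⟩ : ∃ c : (N : ℕ) → Fin N → ℂ, c = fun N k => 1 - ∫ ω,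
      Complex.exp ((inner ℝ t (G N k) : ℝ) * Complex.I *
        ((X 0 ω / normConst P (X 0) N : ℝ) : ℂ)) ∂P := ⟨_, rfl⟩
  have hΦc : ∀ N k, Φ N (inner ℝ t (G N k)) = N * c N k := fun N k => by rw [hΦ, hc]
  have hprod : ∀ N : ℕ, charFun (P.map (normalizedSum P X (G N))) t = ∏ k, (1 - c N k) :=
    fun N => by
      rw [charFun_map_normalizedSum hX hXindep hXident, hc]
      simp
  simp only [hprod]
  obtain ⟨B, hB⟩ := (isCompact_closedBall (0 : ℂ) M).exists_bound_of_continuousOn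
    (hψ.comp hcont).continuousOn
  -- `B` bounds the limiting exponent on the ball, and `N * c N k` is eventually within 1 of that
  -- exponent, uniformly in `k`.
  refine tendsto_prod_one_sub_of_tendsto_sum (K := B + 1) (.of_forall fun N k => ?_) ?_ ?_
  · rw [hc, sub_sub_cancel]
    refine (norm_integral_le_of_norm_le_const (C := 1) (.of_forall fun ω => ?_)).trans (by simp)
    rw [Complex.norm_exp]
    simp
  · filter_upwards [Metric.tendstoUniformlyOn_iff.1 hunif 1 one_pos] with N hN k
    have hk : G N k ∈ Metric.closedBall (0 : ℂ) M := by simpa using hG N k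
    have h1 := hN _ hk
    have h2 := hB _ hk
    rw [hΦc, dist_comm, dist_eq_norm] at h1
    have h3 := norm_le_norm_add_norm_sub' ((N : ℂ) * c N k) (stableExponent α (inner ℝ t (G N k)))
    rw [norm_mul, Complex.norm_natCast] at h3
    simp only [Function.comp] at h2
    linarith
  · refine hsum.congr' ?_
    filter_upwards [eventually_gt_atTop 0] with N hN
    have hN : (N : ℂ) ≠ 0 := by exact_mod_cast hN.ne'
    simp only [hΦc, ← Finset.mul_sum, inv_mul_cancel_left₀ hN]

theorem continuous_integral_stableExponent {α M : ℝ} (hα0 : 0 < α) {ν : Measure ℂ}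
    [IsFiniteMeasure ν] (hM : ∀ᵐ z ∂ν, ‖z‖ ≤ M) :
    Continuous fun t : ℂ => ∫ z, stableExponent α (inner ℝ t z) ∂ν := by
  have hψ := continuous_stableExponent hα0
  refine continuous_iff_continuousAt.2 fun t₀ => ?_
  obtain ⟨B, hB⟩ := (isCompact_closedBall (0 : ℝ) ((‖t₀‖ + 1) * M)).exists_bound_of_continuousOn
    hψ.continuousOn
  refine continuousAt_of_dominated (bound := fun _ => B)
    (.of_forall fun t => (hψ.comp (by fun_prop)).aestronglyMeasurable) ?_ (integrable_const _)
    (.of_forall fun z => (hψ.comp (by fun_prop)).continuousAt)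
  filter_upwards [continuous_norm.continuousAt.eventually_lt_const (lt_add_one ‖t₀‖)] with t ht
  filter_upwards [hM] with z hz
  refine hB _ ?_
  rw [mem_closedBall_zero_iff]
  exact (norm_inner_le_norm t z).trans (by gcongr)

theorem theorem9p3 {Ω : Type*} [MeasurableSpace Ω] (P : Measure Ω) [IsProbabilityMeasure P]
    (α : ℝ) (hα0 : 0 < α) (hα1 : α < 1)
    (X : ℕ → Ω → ℝ) (hXmeas : ∀ k, AEMeasurable (X k) P)
    (hXindep : iIndepFun X P) (hXident : ∀ k, IdentDistrib (X k) (X 0) P P)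
    (hXnonneg : ∀ k, ∀ᵐ ω ∂P, 0 ≤ X k ω)
    (L : ℝ → ℝ) (hL : IsSlowlyVarying L)
    (hXtail : ∀ u : ℝ, 0 < u → P.real {ω | u ≤ X 0 ω} = L u / u ^ α)
    (G : (N : ℕ) → Fin N → ℂ) (hG : ∃ M : ℝ, ∀ (N : ℕ) (k : Fin N), ‖G N k‖ ≤ M)
    (ν : ProbabilityMeasure ℂ)
    (hν : Tendsto (fun N : ℕ => empiricalMeasure (G N)) atTop (𝓝 ν.toFiniteMeasure)) :
    (∃ Q : ProbabilityMeasure ℂ,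
      IsComplexStable α (spectralMeasure α (ν : Measure ℂ)) 0 (Q : Measure ℂ) ∧
      TendstoInDistribution (fun (N : ℕ) (ω : Ω) => normalizedSum P X (G N) ω) atTop
        (fun z : ℂ => z) (fun _ => P) (Q : Measure ℂ)) ∧
    ((ν : Measure ℂ) = Measure.dirac 0 →
      TendstoInDistribution (fun (N : ℕ) (ω : Ω) => normalizedSum P X (G N) ω) atTop
        (fun _ : Ω => (0 : ℂ)) (fun _ => P) P) := by
  obtain ⟨M, hM⟩ := hG
  have hT := isRegVaryingTail_of_isSlowlyVarying (hXnonneg 0) hL hXtail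
  have hSm : ∀ N : ℕ, AEMeasurable (fun ω => normalizedSum P X (G N) ω) P := fun N => by
    unfold normalizedSum
    fun_prop
  have hνM := ae_norm_le_of_tendsto_empiricalMeasure hM hν
  obtain ⟨Q, hQ, hlim⟩ := exists_tendsto_of_tendsto_charFun
    (μ := fun N => ⟨P.map (fun ω => normalizedSum P X (G N) ω),
      Measure.isProbabilityMeasure_map (hSm N)⟩)
    (f := fun t => Complex.exp (-∫ z, stableExponent α (inner ℝ t z) ∂(ν : Measure ℂ)))
    (Complex.continuous_exp.comp
      (continuous_integral_stableExponent hα0 hνM).neg).continuousAt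
    (tendsto_charFun_normalizedSum hα0 hα1 hXmeas hXindep hXident (hXnonneg 0) hT hM hν)
  refine ⟨⟨Q, ⟨isFiniteMeasure_spectralMeasure hα0 hνM, inferInstance, fun t => ?_⟩,
    ⟨hSm, aemeasurable_id', ?_⟩⟩, fun hν0 => ⟨hSm, aemeasurable_const, ?_⟩⟩
  · rw [hQ, integral_spectralMeasure hα0 hα1]
    simp
  · have h : (⟨(Q : Measure ℂ).map fun z => z, Measure.isProbabilityMeasure_map aemeasurable_id'⟩ :
        ProbabilityMeasure ℂ) = Q := Subtype.ext Measure.map_id'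
    rw [h]
    exact hlim
  · have h : (⟨P.map fun _ => (0 : ℂ), Measure.isProbabilityMeasure_map aemeasurable_const⟩ :
        ProbabilityMeasure ℂ) = Q := by
      -- For `ν = δ₀` the exponent is zero, so `Q` has characteristic function 1.
      have hmap : P.map (fun _ => (0 : ℂ)) = (Q : Measure ℂ) := by
        refine Measure.ext_of_charFun (funext fun t => ?_)
        rw [hQ, hν0, integral_dirac, Measure.map_const, measure_univ, one_smul, charFun_dirac]
        simp [stableExponent, hα0.ne']
      exact Subtype.ext hmap
    rw [h]
    exact hlim
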